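/- All graphs are finite, simple and undirected. Let $G$ be a graph. A set $S\subseteq V(G)$ is $\Delta$-convex if no vertex outside $S$ forms a triangle of $G$ with two vertices of $S$. For an integer $p$, a convex $p$-cover of $G$ is a collection $(V_1,\dots,V_p)$ of $\Delta$-convex sets with $V(G)=\bigcup_{i=1}^p V_i$ and $V_i\not\subseteq\bigcup_{j\neq i}V_j$ for every $i$; it is a convex $p$-partition if moreover the $V_i$ are pairwise disjoint. The convex cover number $\varphi_c(G)$ (respectively the convex partition number $\Theta_c(G)$) is the least integer $p\ge 2$ for which $G$ has a convex $p$-cover (respectively a convex $p$-partition). $G$ is chordal if every cycle of length at least $4$ has a chord. $G$ is dually chordal if it has a maximum neighbourhood ordering, i.e. an ordering $v_1,\dots,v_n$ of its vertices such that for every $i$, with $G_i=G[\{v_i,\dots,v_n\}]$, there is a vertex $u\in N_{G_i}[v_i]$ satisfying $N_{G_i}[w]\subseteq N_{G_i}[u]$ for all $w\in N_{G_i}[v_i]$, where $N_H[x]$ is the closed neighbourhood of $x$ in $H$. $G$ is 2-connected if it has at least two vertices, is connected, and remains connected after the deletion of any one vertex ($K_2$ is allowed). **Corollary.** If $G$ is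 a 2-connected graph that is chordal or dually chordal, then $$\varphi_c(G)=\Theta_c(G)=\chi(G).$$ -/

import Mathlib

namespace DeltaConvexity

variable {V : Type*} (G : SimpleGraph V)

/-- The `Δ`-interval of `S`: the vertices of `S`, together with every vertex that forms a triangle
with two vertices of `S`. -/
def deltaInterval (S : Set V) : Set V :=
  S ∪ {w | ∃ u ∈ S, ∃ v ∈ S, G.Adj u v ∧ G.Adj w u ∧ G.Adj w v}

/-- `S` is `Δ`-convex if it equals its own `Δ`-interval. -/
def IsDeltaConvex (S : Set V) : Prop :=
  deltaInterval G S = S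

/-- `C 0, …, C (p - 1)` is a convex `p`-cover of `G`: the sets are `Δ`-convex, they cover the
vertex set, and none of them is contained in the union of the others. -/
def IsConvexCover {p : ℕ} (C : Fin p → Set V) : Prop :=
  (∀ i, IsDeltaConvex G (C i)) ∧
    (⋃ i, C i) = Set.univ ∧
    ∀ i, ¬ C i ⊆ ⋃ j, ⋃ (_ : j ≠ i), C j

/-- A convex `p`-partition of `G` is a convex `p`-cover whose members are pairwise disjoint. -/
def IsConvexPartition {p : ℕ} (C : Fin p → Set V) : Prop :=
  IsConvexCover G C ∧ ∀ i j, i ≠ j → Disjoint (C i) (C j)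

/-- The convex cover number: the least `p ≥ 2` such that `G` has a convex `p`-cover
(it is `⊤` if there is no such `p`). -/
noncomputable def convexCoverNumber : ℕ∞ :=
  ⨅ p ∈ {p : ℕ | 2 ≤ p ∧ ∃ C : Fin p → Set V, IsConvexCover G C}, (p : ℕ∞)

/-- The convex partition number: the least `p ≥ 2` such that `G` has a convex `p`-partition
(it is `⊤` if there is no such `p`). -/
noncomputable def convexPartitionNumber : ℕ∞ :=
  ⨅ p ∈ {p : ℕ | 2 ≤ p ∧ ∃ C : Fin p → Set V, IsConvexPartition G C}, (p : ℕ∞)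

/-- A graph is chordal if every cycle of length at least four has a chord: an edge of the graph
that joins two vertices of the cycle and is not an edge of the cycle. -/
def IsChordal : Prop :=
  ∀ (v : V) (c : G.Walk v v), c.IsCycle → 4 ≤ c.length →
    ∃ x ∈ c.support, ∃ y ∈ c.support, G.Adj x y ∧ s(x, y) ∉ c.edges

/-- For an ordering of the vertices given by `e`, the closed neighbourhood of `w` in the
subgraph induced by `v` and the vertices that come after `v`. -/
def laterClosedNbhd (e : V → ℕ) (v w : V) : Set V :=
  {x | e v ≤ e x ∧ (x = w ∨ G.Adj w x)}

/-- A maximum neighbourhood ordering: writing `G_v` for the subgraph induced by `v` and the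
vertices after `v`, every vertex `v` has a maximum neighbour in `G_v`, that is a vertex `u` in
`N_{G_v}[v]` with `N_{G_v}[w] ⊆ N_{G_v}[u]` for all `w` in `N_{G_v}[v]`.
The ordering is given by an injective numbering `e` of the vertices. -/
def IsMaximumNeighbourhoodOrdering (e : V → ℕ) : Prop :=
  Function.Injective e ∧
    ∀ v, ∃ u ∈ laterClosedNbhd G e v v,
      ∀ w ∈ laterClosedNbhd G e v v, laterClosedNbhd G e v w ⊆ laterClosedNbhd G e v u

/-- A (finite) graph is dually chordal if it has a maximum neighbourhood ordering. -/
def IsDuallyChordal : Prop :=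
  ∃ e : V → ℕ, IsMaximumNeighbourhoodOrdering G e

/-- A graph is 2-connected if it has at least two vertices, is connected, and has no cut vertex,
that is, it stays connected after the removal of any one vertex. (So the complete graph on two
vertices is included.) -/
def IsTwoConnected : Prop :=
  Nontrivial V ∧ G.Connected ∧ ∀ v : V, (G.induce ({v}ᶜ : Set V)).Connected

end DeltaConvexity

namespace DeltaConvexity

variable {V : Type*} {G : SimpleGraph V} {S : Set V}

/-! Everything rests on one fact: in these graphs a proper `Δ`-convex set is independent. A convex
cover then yields a colouring, and an optimal colouring is a convex partition. For independence, let
`x` lie in a `Δ`-convex set `S`. In both classes, connectedness of `G - x` forces the neighbours of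
`x` to be all in `S` or all outside it (the two `mem_of_adj` lemmas for chordal and dually chordal
graphs). So an edge inside `S` spreads over the connected graph `G`, and `S` is everything. -/

theorem IsDeltaConvex.mem_of_adj (hS : IsDeltaConvex G S) {u v w : V} (hu : u ∈ S) (hv : v ∈ S)
    (huv : G.Adj u v) (huw : G.Adj u w) (hvw : G.Adj v w) : w ∈ S := by
  rw [← hS]
  exact Or.inr ⟨u, hu, v, hv, huv, huw.symm, hvw.symm⟩

theorem IsDeltaConvex.of_isIndepSet (hS : G.IsIndepSet S) : IsDeltaConvex G S := by
  refine Set.Subset.antisymm ?_ Set.subset_union_left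
  rintro w (hw | ⟨u, hu, v, hv, huv, -, -⟩)
  · exact hw
  · exact absurd huv (hS hu hv huv.ne)

/-- In a connected graph, a set that contains a vertex and is closed under adjacency contains
every vertex. -/
theorem mem_of_connected_of_closed {W : Type*} {H : SimpleGraph W} (hH : H.Connected) {T : Set W}
    (hT : ∀ c ∈ T, ∀ d, H.Adj c d → d ∈ T) {a : W} (ha : a ∈ T) (b : W) : b ∈ T := by
  obtain ⟨p⟩ := hH.preconnected a b
  induction p with
  | nil => exact ha
  | cons h _ ih => exact ih (hT _ ha _ h)

/-- A `Δ`-convex set with an edge is the whole vertex set, provided that any two edges with a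
common end are both inside the set or both not inside it. -/
theorem eq_univ_of_forall_adj (hc : G.Connected)
    (h : ∀ x ∈ S, ∀ a b, G.Adj x a → G.Adj x b → a ∈ S → b ∈ S)
    {u v : V} (hu : u ∈ S) (hv : v ∈ S) (huv : G.Adj u v) : S = Set.univ := by
  refine Set.eq_univ_of_forall fun w => ?_
  -- Carrying a neighbour in `S` along with each vertex is what lets `h` apply again at the next
  -- one.
  refine (mem_of_connected_of_closed hc (T := {z | z ∈ S ∧ ∃ y ∈ S, G.Adj z y}) ?_
    ⟨hu, v, hv, huv⟩ w).1
  rintro c ⟨hcS, y, hy, hcy⟩ d hcd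
  exact ⟨h c hcS y d hcy hcd hy, c, hcS, hcd.symm⟩

/-! ### Chordal graphs -/

/-- Two positions of a walk that are joined by an edge of the graph which is not an edge of the
walk allow a shortcut. -/
theorem exists_shorter_walk_of_lt {a b : V} (p : G.Walk a b) {i j : ℕ} (hij : i < j)
    (hj : j ≤ p.length) (hadj : G.Adj (p.getVert i) (p.getVert j))
    (he : s(p.getVert i, p.getVert j) ∉ p.edges) :
    ∃ q : G.Walk a b, q.length < p.length ∧ q.support ⊆ p.support := by
  have hne : j ≠ i + 1 := by
    rintro rfl
    exact he ((p.mk_mem_edges_iff_exists).2 ⟨i, hj, rfl⟩)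
  refine ⟨(p.take i).append (.cons hadj (p.drop j)), ?_, ?_⟩
  · simp only [SimpleGraph.Walk.length_append, SimpleGraph.Walk.length_cons,
      SimpleGraph.Walk.take_length, SimpleGraph.Walk.drop_length]
    omega
  · intro z hz
    rw [SimpleGraph.Walk.mem_support_append_iff, SimpleGraph.Walk.support_cons,
      List.mem_cons] at hz
    rcases hz with hz | rfl | hz
    · exact (p.isSubwalk_take i).support_subset hz
    · exact p.getVert_mem_support i
    · exact (p.isSubwalk_drop j).support_subset hz

theorem exists_shorter_walk_of_adj {a b : V} (p : G.Walk a b) {c d : V} (hc : c ∈ p.support)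
    (hd : d ∈ p.support) (hadj : G.Adj c d) (he : s(c, d) ∉ p.edges) :
    ∃ q : G.Walk a b, q.length < p.length ∧ q.support ⊆ p.support := by
  obtain ⟨i, rfl, hi⟩ := SimpleGraph.Walk.mem_support_iff_exists_getVert.1 hc
  obtain ⟨j, rfl, hj⟩ := SimpleGraph.Walk.mem_support_iff_exists_getVert.1 hd
  rcases lt_trichotomy i j with h | rfl | h
  · exact exists_shorter_walk_of_lt p h hj hadj he
  · exact absurd rfl hadj.ne
  · exact exists_shorter_walk_of_lt p h hi hadj.symm (by rwa [Sym2.eq_swap])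

/-- Induction on the length of the walk. If no shorter walk stays in its support, it is a path, and
joining its ends to `x` gives a cycle unless the ends are equal or adjacent. A chord avoiding `x`
would shorten the path, so some chord is `xz`, and membership passes from `a` to `z` to `b` along
the two shorter pieces. -/
theorem IsChordal.mem_of_walk (hG : IsChordal G) (hS : IsDeltaConvex G S) {x : V} (hx : x ∈ S)
    {a b : V} (p : G.Walk a b) (hp : x ∉ p.support) (hxa : G.Adj x a) (hxb : G.Adj x b)
    (ha : a ∈ S) : b ∈ S := by
  classical
  induction hn : p.length using Nat.strong_induction_on generalizing a b with
  | _ n ih =>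
  subst hn
  by_cases hq : ∃ q : G.Walk a b, q.length < p.length ∧ q.support ⊆ p.support
  · obtain ⟨q, hlt, hsub⟩ := hq
    exact ih _ hlt q (fun h => hp (hsub h)) hxa hxb ha rfl
  have hpath : p.IsPath := by
    by_contra hnp
    refine hq ⟨p.bypass, lt_of_not_ge fun hle => hnp ?_, p.support_bypass_subset_support⟩
    rw [← p.bypass_eq_self_of_length_le_length_bypass hle]
    exact p.bypass_isPath
  rcases eq_or_ne a b with rfl | hab
  · exact ha
  by_cases hadj : G.Adj a b
  · exact hS.mem_of_adj hx ha hxa hxb hadj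
  have hlen : 2 ≤ p.length := by
    by_contra! hlt
    interval_cases h : p.length
    · exact hab (SimpleGraph.Walk.eq_of_length_eq_zero h)
    · exact hadj (SimpleGraph.Walk.adj_of_length_eq_one h)
  have hcyc : (SimpleGraph.Walk.cons hxa (p.concat hxb.symm)).IsCycle := by
    rw [SimpleGraph.Walk.cons_isCycle_iff]
    refine ⟨hpath.concat hp _, fun hmem => ?_⟩
    rw [SimpleGraph.Walk.edges_concat, List.concat_eq_append, List.mem_append,
      List.mem_singleton] at hmem
    rcases hmem with hmem | hmem
    · exact hp (p.fst_mem_support_of_mem_edges hmem)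
    · rw [Sym2.eq_iff] at hmem
      rcases hmem with ⟨h, -⟩ | ⟨-, h⟩
      · exact hxb.ne h
      · exact hab h
  obtain ⟨c, hc, d, hd, hcd, hne⟩ := hG x _ hcyc (by
    rw [SimpleGraph.Walk.length_cons, SimpleGraph.Walk.length_concat]; omega)
  have key : ∀ z ∈ p.support, G.Adj x z → z ≠ a → z ≠ b → b ∈ S := by
    intro z hz hxz hza hzb
    have hzS : z ∈ S := ih _ (p.length_takeUntil_lt_length hz hzb) (p.takeUntil z hz)
      (fun h => hp (p.support_takeUntil_subset_support hz h)) hxa hxz ha rfl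
    exact ih _ (p.length_dropUntil_lt_length hz hza) (p.dropUntil z hz)
      (fun h => hp (p.support_dropUntil_subset_support hz h)) hxz hxb hzS rfl
  simp only [SimpleGraph.Walk.support_cons, SimpleGraph.Walk.support_concat,
    SimpleGraph.Walk.edges_cons, SimpleGraph.Walk.edges_concat, List.concat_eq_append,
    List.mem_cons, List.mem_append, List.not_mem_nil, or_false,
    not_or] at hc hd hne
  obtain ⟨hne1, hne2, hne3⟩ := hne
  have hc' : c = x ∨ c ∈ p.support := by tauto
  have hd' : d = x ∨ d ∈ p.support := by tauto
  rcases hc' with rfl | hc'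
  · rcases hd' with rfl | hd'
    · exact absurd rfl hcd.ne
    · exact key d hd' hcd (fun h => hne1 (by rw [h])) (fun h => hne3 (by rw [h, Sym2.eq_swap]))
  · rcases hd' with rfl | hd'
    · exact key c hc' hcd.symm (fun h => hne1 (by rw [h, Sym2.eq_swap])) (fun h => hne3 (by rw [h]))
    · exact absurd (exists_shorter_walk_of_adj p hc' hd' hcd hne2) hq

theorem IsChordal.mem_of_adj (hG : IsChordal G) (h2 : IsTwoConnected G) (hS : IsDeltaConvex G S)
    {x : V} (hx : x ∈ S) {a b : V} (hxa : G.Adj x a) (hxb : G.Adj x b) (ha : a ∈ S) :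
    b ∈ S := by
  have hax : a ∈ ({x}ᶜ : Set V) := hxa.ne'
  have hbx : b ∈ ({x}ᶜ : Set V) := hxb.ne'
  obtain ⟨p⟩ := (h2.2.2 x).preconnected ⟨a, hax⟩ ⟨b, hbx⟩
  let f := (SimpleGraph.Embedding.induce (G := G) ({x}ᶜ : Set V)).toHom
  refine hG.mem_of_walk hS hx (p.map f) (fun hmem => ?_) hxa hxb ha
  obtain ⟨y, -, hy⟩ := List.mem_map.1 ((congrArg (x ∈ ·) (SimpleGraph.Walk.support_map f p)).mp hmem)
  exact y.2 hy

/-! ### Dually chordal graphs -/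

/-- For a maximum neighbourhood ordering and a `Δ`-convex set `S`, in the subgraph induced by the
vertices numbered at least `k`, the neighbours of `x ∈ S` that lie in `S` are separated from its
other neighbours by the deletion of `x`. -/
theorem IsMaximumNeighbourhoodOrdering.exists_separation {e : V → ℕ}
    (he : IsMaximumNeighbourhoodOrdering G e) (hS : IsDeltaConvex G S) {N : ℕ}
    (hN : ∀ v, e v < N) {k : ℕ} (hk : k ≤ N) :
    ∀ x ∈ S, k ≤ e x → ∃ T : Set V,
      (∀ c ∈ T, ∀ d, G.Adj c d → k ≤ e c → k ≤ e d → c ≠ x → d ≠ x → d ∈ T) ∧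
      ∀ a, G.Adj x a → k ≤ e a → (a ∈ T ↔ a ∈ S) := by
  -- Vertices are put back one at a time, the last in the ordering first; `v` is the one being
  -- added.
  induction hk using Nat.decreasingInduction with
  | self => exact fun x _ h => absurd (hN x) h.not_gt
  | of_succ k hk ih =>
  intro x hx hkx
  by_cases hv : ∃ v, e v = k
  swap
  · have hs : ∀ y, k ≤ e y → k + 1 ≤ e y := fun y hy =>
      Nat.succ_le_of_lt (lt_of_le_of_ne hy fun h => hv ⟨y, h.symm⟩)
    obtain ⟨T, hT1, hT2⟩ := ih x hx (hs x hkx)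
    exact ⟨T, fun c hc d hcd hkc hkd => hT1 c hc d hcd (hs c hkc) (hs d hkd),
      fun a hxa hka => hT2 a hxa (hs a hka)⟩
  obtain ⟨v, rfl⟩ := hv
  have hs : ∀ y, e v ≤ e y → y ≠ v → e v + 1 ≤ e y := fun y hy hne =>
    Nat.succ_le_of_lt (lt_of_le_of_ne hy fun h => hne (he.1 h.symm))
  have hS' : ∀ {y a b : V}, y ∈ S → G.Adj y a → G.Adj y b → G.Adj a b → (a ∈ S ↔ b ∈ S) :=
    fun hy ha hb hab => ⟨fun h => hS.mem_of_adj hy h ha hb hab,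
      fun h => hS.mem_of_adj hy h hb ha hab.symm⟩
  obtain ⟨u, ⟨hku, huv⟩, hmax⟩ := he.2 v
  rcases eq_or_ne u v with rfl | hne
  -- If `v` is its own maximum neighbour, its closed neighbourhood is a whole component.
  · have hcl : ∀ c d, G.Adj u c → e u ≤ e c → G.Adj c d → e u ≤ e d → d = u ∨ G.Adj u d :=
      fun c d huc hkc hcd hkd => (hmax c ⟨hkc, Or.inr huc⟩ ⟨hkd, Or.inr hcd⟩).2
    rcases eq_or_ne x u with rfl | hxu
    · refine ⟨{a | G.Adj x a ∧ a ∈ S}, ?_, fun a hxa _ => and_iff_right hxa⟩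
      rintro c ⟨hxc, hcS⟩ d hcd hkc hkd - hdx
      have hxd := (hcl c d hxc hkc hcd hkd).resolve_left hdx
      exact ⟨hxd, (hS' hx hxc hxd hcd).1 hcS⟩
    · by_cases hux : G.Adj u x
      -- Every neighbour of `x` is `u` or forms a triangle with `x` and `u`, so all agree with `u`:
      -- everything or nothing serves as `T`.
      · refine ⟨{_a | u ∈ S}, fun c hc d _ _ _ _ _ => hc, fun a hxa hka => ?_⟩
        rcases hcl x a hux hkx hxa hka with rfl | hua
        · rfl
        · exact hS' hx hux.symm hxa hua
      -- Here `x` lies outside the component of `u`, which can be cut out of `T`.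
      · obtain ⟨T, hT1, hT2⟩ := ih x hx (hs x hkx hxu)
        have hnot : ∀ a, G.Adj x a → e u ≤ e a → a ≠ u ∧ ¬ G.Adj u a := by
          intro a hxa hka
          refine ⟨?_, fun hua => ?_⟩
          · rintro rfl
            exact hux hxa.symm
          · exact (hcl a x hua hka hxa.symm hkx).elim hxu hux
        refine ⟨{a | a ∈ T ∧ a ≠ u ∧ ¬ G.Adj u a}, ?_, fun a hxa hka => ?_⟩
        · rintro c ⟨hcT, hcu, huc⟩ d hcd hkc hkd hcx hdx
          have hdu : d ≠ u := by
            rintro rfl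
            exact huc hcd.symm
          refine ⟨hT1 c hcT d hcd (hs c hkc hcu) (hs d hkd hdu) hcx hdx, hdu, fun hud => ?_⟩
          exact (hcl d c hud hkd hcd.symm hkc).elim hcu huc
        · obtain ⟨hau, hua⟩ := hnot a hxa hka
          rw [Set.mem_ofPred_eq, and_iff_left ⟨hau, hua⟩]
          exact hT2 a hxa (hs a hka hau)
  · have huv' : G.Adj v u := huv.resolve_left hne
    -- From here on only `N[v] ⊆ N[u]` matters.
    have hdom : ∀ c, G.Adj v c → e v ≤ e c → c ≠ u → G.Adj u c := fun c hvc hkc hcu =>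
      (hmax v ⟨le_rfl, Or.inl rfl⟩ ⟨hkc, Or.inr hvc⟩).2.resolve_left hcu
    rcases eq_or_ne x v with rfl | hxv
    · refine ⟨{_a | u ∈ S}, fun c hc d _ _ _ _ _ => hc, fun a hxa hka => ?_⟩
      rcases eq_or_ne a u with rfl | hau
      · rfl
      · exact hS' hx huv' hxa (hdom a hxa hka hau)
    obtain ⟨T, hT1, hT2⟩ := ih x hx (hs x hkx hxv)
    -- `P` decides on which side of the separation `v` goes.
    have ext : ∀ P : Prop, (∀ c, G.Adj v c → e v + 1 ≤ e c → c ≠ x → (c ∈ T ↔ P)) →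
        (G.Adj x v → (P ↔ v ∈ S)) → ∃ T : Set V,
        (∀ c ∈ T, ∀ d, G.Adj c d → e v ≤ e c → e v ≤ e d → c ≠ x → d ≠ x → d ∈ T) ∧
        ∀ a, G.Adj x a → e v ≤ e a → (a ∈ T ↔ a ∈ S) := by
      intro P hP1 hP2
      refine ⟨{a | a = v ∧ P ∨ a ≠ v ∧ a ∈ T}, ?_, fun a hxa hka => ?_⟩
      · rintro c hc d hcd hkc hkd hcx hdx
        rcases hc with ⟨rfl, hP⟩ | ⟨hcv, hcT⟩
        · exact Or.inr ⟨hcd.ne', (hP1 d hcd (hs d hkd hcd.ne') hdx).2 hP⟩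
        · rcases eq_or_ne d v with rfl | hdv
          · exact Or.inl ⟨rfl, (hP1 c hcd.symm (hs c hkc hcv) hcx).1 hcT⟩
          · exact Or.inr ⟨hdv, hT1 c hcT d hcd (hs c hkc hcv) (hs d hkd hdv) hcx hdx⟩
      · rcases eq_or_ne a v with rfl | hav
        · simpa using hP2 hxa
        · simpa [hav] using hT2 a hxa (hs a hka hav)
    rcases eq_or_ne x u with rfl | hxu
    · refine ext (v ∈ S) (fun c hvc hkc hcx => ?_) fun _ => Iff.rfl
      have hxc := hdom c hvc (by omega) hcx
      exact (hT2 c hxc hkc).trans (hS' hx hxc huv'.symm hvc.symm)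
    -- Apart from `x`, the neighbours of `v` are `u` or adjacent to `u`, so `v` joins the side of
    -- `u`.
    · refine ext (u ∈ T) (fun c hvc hkc hcx => ?_) fun hxv' => ?_
      · rcases eq_or_ne c u with rfl | hcu
        · rfl
        have huc := hdom c hvc (by omega) hcu
        exact ⟨fun h => hT1 c h u huc.symm hkc (hs u hku hne) hcx hxu.symm,
          fun h => hT1 u h c huc (hs u hku hne) hkc hxu.symm hcx⟩
      · have hux := hdom x hxv'.symm hkx hxu
        exact (hT2 u hux.symm (hs u hku hne)).trans (hS' hx hux.symm hxv' huv'.symm)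

theorem IsDuallyChordal.mem_of_adj [Finite V] (hG : IsDuallyChordal G) (h2 : IsTwoConnected G)
    (hS : IsDeltaConvex G S) {x : V} (hx : x ∈ S) {a b : V} (hxa : G.Adj x a)
    (hxb : G.Adj x b) (ha : a ∈ S) : b ∈ S := by
  obtain ⟨e, he⟩ := hG
  obtain ⟨N, hN⟩ := (Set.finite_range e).bddAbove
  obtain ⟨T, hT1, hT2⟩ := he.exists_separation hS (N := N + 1)
    (fun v => Nat.lt_succ_of_le (hN ⟨v, rfl⟩)) (Nat.zero_le _) x hx (Nat.zero_le _)
  -- At `k = 0` the subgraph is all of `G`; since `G - x` is connected, `T` cannot separate `a` from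
  -- `b`.
  refine (hT2 b hxb (Nat.zero_le _)).1 ?_
  refine mem_of_connected_of_closed (h2.2.2 x) (T := {y | (y : V) ∈ T}) ?_
    (a := ⟨a, hxa.ne'⟩) ((hT2 a hxa (Nat.zero_le _)).2 ha) ⟨b, hxb.ne'⟩
  exact fun c hc d hcd => hT1 c hc d hcd (Nat.zero_le _) (Nat.zero_le _) c.2 d.2

/-! ### Convex covers and colourings -/

theorem IsDeltaConvex.isIndepSet [Finite V] (h2 : IsTwoConnected G)
    (hG : IsChordal G ∨ IsDuallyChordal G) (hS : IsDeltaConvex G S) (hne : S ≠ Set.univ) :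
    G.IsIndepSet S := by
  intro u hu v hv _ huv
  refine hne (eq_univ_of_forall_adj h2.2.1 (fun x hx a b hxa hxb ha => ?_) hu hv huv)
  rcases hG with hG | hG
  · exact hG.mem_of_adj h2 hS hx hxa hxb ha
  · exact hG.mem_of_adj h2 hS hx hxa hxb ha

theorem IsConvexCover.ne_univ {p : ℕ} (hp : 2 ≤ p) {C : Fin p → Set V} (hC : IsConvexCover G C)
    (i : Fin p) : C i ≠ Set.univ := by
  intro hi
  have : Nontrivial (Fin p) := Fin.nontrivial_iff_two_le.2 hp
  obtain ⟨j, hj⟩ := exists_ne i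
  refine hC.2.2 j fun w _ => Set.mem_iUnion₂.2 ⟨i, hj.symm, ?_⟩
  rw [hi]
  trivial

theorem IsConvexCover.colorable {p : ℕ} {C : Fin p → Set V} (hC : IsConvexCover G C)
    (hind : ∀ i, G.IsIndepSet (C i)) : G.Colorable p := by
  have hcov : ∀ v, ∃ i, v ∈ C i := fun v => Set.mem_iUnion.1 (hC.2.1 ▸ Set.mem_univ v)
  choose f hf using hcov
  exact ⟨SimpleGraph.Coloring.mk f fun {u v} huv h =>
    hind (f u) (hf u) (h ▸ hf v) huv.ne huv⟩

theorem isConvexPartition_of_surjective {p : ℕ} (c : G.Coloring (Fin p))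
    (hc : Function.Surjective c) : IsConvexPartition G fun i => {v | c v = i} := by
  refine ⟨⟨fun i => ?_, ?_, fun i hsub => ?_⟩, fun i j hij => ?_⟩
  · refine IsDeltaConvex.of_isIndepSet fun u hu v hv _ huv => c.valid huv ?_
    exact hu.trans hv.symm
  · exact Set.eq_univ_of_forall fun v => Set.mem_iUnion.2 ⟨c v, rfl⟩
  · obtain ⟨v, hv⟩ := hc i
    obtain ⟨j, hj, hvj⟩ := Set.mem_iUnion₂.1 (hsub hv)
    exact hj (hvj.symm.trans hv)
  · exact Set.disjoint_left.2 fun v hi hj => hij (hi.symm.trans hj)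

theorem convexCoverNumber_le_convexPartitionNumber :
    convexCoverNumber G ≤ convexPartitionNumber G :=
  biInf_mono fun _ hp => ⟨hp.1, hp.2.imp fun _ hC => hC.1⟩

/-- An optimal colouring uses all its colours, so no class is covered by the others; the bound `2 ≤
χ` meets the requirement `2 ≤ p`. -/
theorem convexPartitionNumber_le_chromaticNumber [Finite V] (h : 2 ≤ G.chromaticNumber) :
    convexPartitionNumber G ≤ G.chromaticNumber := by
  obtain ⟨n, hn⟩ : ∃ n : ℕ, (n : ℕ∞) = G.chromaticNumber :=
    ENat.ne_top_iff_exists.1 (SimpleGraph.chromaticNumber_ne_top_iff_exists.2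
      ⟨_, (SimpleGraph.colorable_chromaticNumber_of_fintype G)⟩)
  rw [← hn] at h ⊢
  obtain ⟨c⟩ := SimpleGraph.chromaticNumber_le_iff_colorable.1 hn.ge
  exact iInf₂_le n ⟨by exact_mod_cast h, _, isConvexPartition_of_surjective c
    (SimpleGraph.le_chromaticNumber_iff_forall_surjective.1 hn.le c)⟩

theorem chromaticNumber_le_convexCoverNumber [Finite V] (h2 : IsTwoConnected G)
    (hG : IsChordal G ∨ IsDuallyChordal G) : G.chromaticNumber ≤ convexCoverNumber G := by
  refine le_iInf₂ fun p ⟨hp, C, hC⟩ => (hC.colorable fun i => ?_).chromaticNumber_le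
  exact (hC.1 i).isIndepSet h2 hG (hC.ne_univ hp i)

theorem IsTwoConnected.two_le_chromaticNumber (h2 : IsTwoConnected G) :
    2 ≤ G.chromaticNumber := by
  have := h2.1
  obtain ⟨v⟩ := h2.2.1.nonempty
  obtain ⟨w, hw⟩ := h2.2.1.preconnected.exists_adj_of_nontrivial v
  exact SimpleGraph.two_le_chromaticNumber_of_adj hw

end DeltaConvexity

theorem mainTheorem4 {V : Type*} [Finite V] (G : SimpleGraph V)
    (h2 : DeltaConvexity.IsTwoConnected G)
    (hG : DeltaConvexity.IsChordal G ∨ DeltaConvexity.IsDuallyChordal G) :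
    DeltaConvexity.convexCoverNumber G = DeltaConvexity.convexPartitionNumber G ∧
      DeltaConvexity.convexPartitionNumber G = G.chromaticNumber := by
  have h1 := DeltaConvexity.convexCoverNumber_le_convexPartitionNumber (G := G)
  have h3 := DeltaConvexity.convexPartitionNumber_le_chromaticNumber h2.two_le_chromaticNumber
  have h4 := DeltaConvexity.chromaticNumber_le_convexCoverNumber h2 hG
  exact ⟨h1.antisymm (h3.trans h4), h3.antisymm (h4.trans h1)⟩
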